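/- **Definitions.** A *simple extended matrix* $M$ consists of integers $n\ge 1$, $m\ge 0$, $k\ge 1$ and (not necessarily distinct) variables $x_{ij},y_i\in\{x_1,\dots,x_k\}$ for $1\le i\le n$, $1\le j\le m$; it is displayed as $$M=\left[\begin{array}{ccc|c} x_{11}&\cdots&x_{1m}&y_1\\ \vdots&&\vdots&\vdots\\ x_{n1}&\cdots&x_{nm}&y_n\end{array}\right].$$ An internal $n$-ary relation (monomorphism) $r\colon R\rightarrowtail A^n$ in a finitely complete category $\mathbb C$ is *$M$-closed* if, for every object $B$ and every function $f\colon\{x_1,\dots,x_k\}\to\mathbb C(B,A)$ such that, for each $j\in\{1,\dots,m\}$, the morphism $(f(x_{1j}),\dots,f(x_{nj}))\colon B\to A^n$ factors through $r$, the morphism $(f(y_1),\dots,f(y_n))\colon B\to A^n$ also factors through $r$. The category $\mathbb C$ *has $M$-closed relations* if all its internal $n$-ary relations are $M$-closed. For a collection $\mathcal C$ of finitely complete categories, $M_1\Rightarrow_{\mathcal C}M_2$ means that every category in $\mathcal C$ with $M_1$-closed relations has $M_2$-closed relations. We write $\mathsf{lex}$, $\mathsf{reg}$, $\mathsf{alg}$,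 $\mathsf{ess\,alg}$ and $\mathsf{reg\,ess\,alg}$ for the collections of, respectively: finitely complete categories; regular categories (finitely complete, with coequalizers of kernel pairs and pullback-stable regular epimorphisms); one-sorted finitary varieties of universal algebras; essentially algebraic categories (those equivalent to the category $\mathsf{Mod}(\Gamma)$ of models of a many-sorted, possibly infinitary, essentially algebraic theory $\Gamma$ with a set of sorts and a set of operation symbols, each partial operation being defined exactly where a given set of equations between terms in total operations holds); and categories that are both regular and essentially algebraic. A subscript $\ast$ restricts the collection to pointed categories, i.e., those with a zero object. For $n'\ge 2$, $\mathsf{Cube}_{n'}$ is the simple extended matrix with $n'$ rows and variables $x_1,x_2$ whose $2^{n'}-1$ left columns are, in lexicographic order, all the $n'$-tuples of elements of $\{x_1,x_2\}$ other than $(x_1,\dots,x_1)$, and whose right column is $(x_1,\dots,x_1)$. Finally, $\mathbb V_M$ is the variety with one basic operation $p$, of arity $m$, and the axioms $p(x_{i1},\dots,x_{im})=y_i$ for $i\in\{1,\dots,n\}$. **Theorem.** Let $M$ be a simple extended matrix as above and let $n'\ge 2$ be an integer. The following statements are equivalent: (a) $M\Rightarrow_{\mathsf{lex}}\mathsf{Cube}_{n'}$;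 (b) $M\Rightarrow_{\mathsf{lex}_\ast}\mathsf{Cube}_{n'}$; (c) $M\Rightarrow_{\mathsf{reg}}\mathsf{Cube}_{n'}$; (d) $M\Rightarrow_{\mathsf{reg}_\ast}\mathsf{Cube}_{n'}$; (e) $M\Rightarrow_{\mathsf{alg}}\mathsf{Cube}_{n'}$; (f) $M\Rightarrow_{\mathsf{alg}_\ast}\mathsf{Cube}_{n'}$; (g) $M\Rightarrow_{\mathsf{ess\,alg}}\mathsf{Cube}_{n'}$; (h) $M\Rightarrow_{\mathsf{ess\,alg}_\ast}\mathsf{Cube}_{n'}$; (i) $M\Rightarrow_{\mathsf{reg\,ess\,alg}}\mathsf{Cube}_{n'}$; (j) $M\Rightarrow_{\mathsf{reg\,ess\,alg}_\ast}\mathsf{Cube}_{n'}$; (k) there exist $i_1,\dots,i_{n'}\in\{1,\dots,n\}$ (not necessarily distinct) such that there is no $j\in\{1,\dots,m\}$ with $x_{i_aj}=y_{i_a}$ for each $a\in\{1,\dots,n'\}$; (l) there is no function $p\colon\{0,1\}^m\to\{0,1\}$ making $(\{0,1\},p)$ an algebra of $\mathbb V_M$ such that the induced operation $p^{n'}$ on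 $\{0,1\}^{n'}$ preserves the relation $R_{n'}=\{0,1\}^{n'}\setminus\{(0,\dots,0)\}$, i.e., $p^{n'}(r_1,\dots,r_m)\in R_{n'}$ for all $r_1,\dots,r_m\in R_{n'}$. -/

import Mathlib

open CategoryTheory CategoryTheory.Limits

universe w v u

/-! ## Simple extended matrices of variables and closed relations -/

/-- A simple extended matrix `[x_{ij} | y_i]` with `n ≥ 1` rows, `m` left columns and one right
column, whose entries are variables from `{x_1, …, x_k}` (represented by `Fin k`). -/
structure SimpleExtendedMatrix where
  /-- the number of rows -/
  n : ℕ
  /-- the number of left columns -/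
  m : ℕ
  /-- the number of variables -/
  k : ℕ
  n_pos : 1 ≤ n
  /-- the left columns -/
  x : Fin n → Fin m → Fin k
  /-- the right column -/
  y : Fin n → Fin k

namespace SimpleExtendedMatrix

/-- The internal `n`-ary relation `r : R ↪ Aⁿ` is `M`-closed: for every object `B` and every
interpretation `f` of the variables as morphisms `B ⟶ A`, if all the morphisms `B ⟶ Aⁿ` given by
the left columns factor through `r`, then so does the one given by the right column. -/
def IsClosedRelation (M : SimpleExtendedMatrix) {C : Type u} [Category.{v} C] [HasFiniteLimits C]
    {A R : C} (r : R ⟶ ∏ᶜ fun _ : Fin M.n => A) : Prop :=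
  ∀ (B : C) (f : Fin M.k → (B ⟶ A)),
    (∀ j : Fin M.m, ∃ g : B ⟶ R, g ≫ r = Pi.lift fun i => f (M.x i j)) →
      ∃ g : B ⟶ R, g ≫ r = Pi.lift fun i => f (M.y i)

/-- The finitely complete category `C` has `M`-closed relations. -/
def HasClosedRelations (M : SimpleExtendedMatrix) (C : Type u) [Category.{v} C]
    [HasFiniteLimits C] : Prop :=
  ∀ (A R : C) (r : R ⟶ ∏ᶜ fun _ : Fin M.n => A) [Mono r], M.IsClosedRelation r

/-- The matrix `Cube_n`. Its variables are `x_1, x_2`, represented by `0, 1 : Fin 2`; its left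
columns are, in lexicographic order, all the `n`-tuples of variables except `(x_1, …, x_1)`, and
its right column is `(x_1, …, x_1)`. The `j`-th left column (`j` counted from `0`) consists of the
`n` binary digits of `j + 1`, the first row holding the most significant digit. -/
def cube (n : ℕ) (hn : 2 ≤ n) : SimpleExtendedMatrix where
  n := n
  m := 2 ^ n - 1
  k := 2
  n_pos := le_trans (by norm_num) hn
  x := fun i j =>
    finFunctionFinEquiv.symm (⟨(j : ℕ) + 1, by have := j.isLt; omega⟩ : Fin (2 ^ n)) i.rev
  y := fun _ => 0

end SimpleExtendedMatrix

/-! ## Varieties -/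

/-- An equational presentation of a one-sorted finitary variety: a small signature of finitary
operation symbols (a first-order language without relation symbols) and a set of equations
between terms in countably many variables. -/
structure EquationalTheory where
  /-- the signature -/
  lang : FirstOrder.Language.{w, 0}
  isAlgebraic : lang.IsAlgebraic
  /-- the equations -/
  eqs : Set (lang.Term ℕ × lang.Term ℕ)

namespace EquationalTheory

/-- The (possibly empty) algebra `A` with operations `str` satisfies the equations of `T`. -/
def IsModel (T : EquationalTheory.{w}) (A : Type u) (str : T.lang.Structure A) : Prop :=
  ∀ e ∈ T.eqs, ∀ a : ℕ → A, e.1.realize a = e.2.realize a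

/-- The algebras of the variety presented by `T`. -/
structure Alg (T : EquationalTheory.{w}) where
  /-- the underlying set -/
  carrier : Type w
  [str : T.lang.Structure carrier]
  isModel : T.IsModel carrier str

attribute [instance] Alg.str

/-- The variety presented by `T`, as the category of algebras and homomorphisms. -/
instance (T : EquationalTheory.{w}) : Category.{w} (Alg T) where
  Hom A B := FirstOrder.Language.Hom T.lang A.carrier B.carrier
  id A := FirstOrder.Language.Hom.id T.lang A.carrier
  comp f g := FirstOrder.Language.Hom.comp g f

end EquationalTheory

namespace SimpleExtendedMatrix

/-- The signature with a single operation symbol, of arity `m`. -/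
inductive SingleOp (m : ℕ) : ℕ → Type w
  | p : SingleOp m m

/-- The theory of the variety `V_M`: one basic `m`-ary operation `p` and, for each row `i` of `M`,
the axiom `p(x_{i1}, …, x_{im}) = y_i`. -/
def theory (M : SimpleExtendedMatrix) : EquationalTheory.{w} where
  lang := ⟨SingleOp M.m, fun _ => PEmpty⟩
  isAlgebraic := fun _ => inferInstanceAs (IsEmpty PEmpty)
  eqs := Set.range fun i : Fin M.n =>
    (FirstOrder.Language.Term.func (SingleOp.p : SingleOp M.m M.m)
        fun j => FirstOrder.Language.Term.var (M.x i j : ℕ),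
      FirstOrder.Language.Term.var (M.y i : ℕ))

/-- The structure `(A, p)` in the signature of `V_M` given by an `m`-ary operation `p` on `A`. -/
@[reducible]
def opStructure (M : SimpleExtendedMatrix) {A : Type u} (p : (Fin M.m → A) → A) :
    (theory.{w} M).lang.Structure A where
  funMap := fun {_} σ => match σ with
    | SingleOp.p => p
  RelMap := fun {_} r => PEmpty.elim r

end SimpleExtendedMatrix

/-! ## Essentially algebraic categories -/

/-- A many-sorted signature with set of sorts `S`; arities are arbitrary small sets. -/
structure SortedSignature (S : Type w) where
  /-- the operation symbols -/
  Op : Type w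
  /-- the index set `U` of the arguments of `σ : ∏_{u ∈ U} s_u → s` -/
  Arity : Op → Type w
  /-- the sort `s_u` of an argument -/
  dom : ∀ σ, Arity σ → S
  /-- the sort `s` of the value -/
  cod : Op → S

namespace SortedSignature

variable {S : Type w} (Sg : SortedSignature S)

/-- The terms, by sort, in a family of variables `x : X` of sorts `τ x`. -/
inductive Term {X : Type w} (τ : X → S) : S → Type w
  | var (x : X) : Term τ (τ x)
  | app (σ : Sg.Op) (args : ∀ i : Sg.Arity σ, Term τ (Sg.dom σ i)) : Term τ (Sg.cod σ)

/-- The equations between two terms of the same sort in variables of sorts `τ`. -/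
structure Equation {X : Type w} (τ : X → S) where
  /-- the common sort of the two sides -/
  sort : S
  /-- the left-hand side -/
  lhs : Sg.Term τ sort
  /-- the right-hand side -/
  rhs : Sg.Term τ sort

/-- All the operation symbols occurring in the term belong to the set `T`. -/
def Term.OpsIn {Sg : SortedSignature S} (T : Set Sg.Op) {X : Type w} {τ : X → S} :
    ∀ {s : S}, Sg.Term τ s → Prop
  | _, .var _ => True
  | _, .app σ args => σ ∈ T ∧ ∀ i, (args i).OpsIn T

/-- A partial algebra: a sorted set with a partial function for each operation symbol. -/
structure PartialAlgebra where
  /-- the underlying `S`-sorted set -/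
  carrier : S → Type w
  /-- the partial operations -/
  op : ∀ σ : Sg.Op, (∀ i : Sg.Arity σ, carrier (Sg.dom σ i)) →. carrier (Sg.cod σ)

/-- The partial value of a term at an assignment `a` of its variables; it is defined when the
values of all subterms are. -/
def PartialAlgebra.eval {Sg : SortedSignature S} (A : Sg.PartialAlgebra) {X : Type w} {τ : X → S}
    (a : ∀ x, A.carrier (τ x)) : ∀ {s : S}, Sg.Term τ s → Part (A.carrier s)
  | _, .var x => Part.some (a x)
  | _, .app σ args =>
      Part.assert (∀ i, (A.eval a (args i)).Dom) fun h =>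
        A.op σ fun i => (A.eval a (args i)).get (h i)

end SortedSignature

/-- An essentially algebraic theory `Γ = (S, Σ, E, Σ_t, Def)`. -/
structure EssentiallyAlgebraicTheory where
  /-- the sorts -/
  S : Type w
  /-- the signature `Σ` -/
  Sg : SortedSignature S
  /-- the index set of the set `E` of equations -/
  E : Type w
  /-- the variables of an equation of `E` -/
  EVar : E → Type w
  /-- the sorts of these variables -/
  eSort : ∀ e, EVar e → S
  /-- the equations of `E` -/
  eqn : ∀ e, Sg.Equation (eSort e)
  /-- the set `Σ_t` of total operation symbols -/
  total : Set Sg.Op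
  /-- the equations defining the domain of a symbol outside `Σ_t`, in its arguments -/
  Def : ∀ σ, σ ∉ total → Set (Sg.Equation (Sg.dom σ))
  def_total : ∀ σ hσ, ∀ q ∈ Def σ hσ, q.lhs.OpsIn total ∧ q.rhs.OpsIn total

namespace EssentiallyAlgebraicTheory

/-- The models of `Γ`. -/
structure Model (Γ : EssentiallyAlgebraicTheory.{w}) extends Γ.Sg.PartialAlgebra where
  op_total : ∀ σ ∈ Γ.total, ∀ a, (op σ a).Dom
  op_dom_iff : ∀ σ (hσ : σ ∉ Γ.total), ∀ a, (op σ a).Dom ↔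
    ∀ q ∈ Γ.Def σ hσ, toPartialAlgebra.eval a q.lhs = toPartialAlgebra.eval a q.rhs
  /-- the equations of `E` hold wherever both of their sides are defined -/
  sat : ∀ e, ∀ a : (∀ x, carrier (Γ.eSort e x)),
    ∀ b ∈ toPartialAlgebra.eval a (Γ.eqn e).lhs,
      ∀ c ∈ toPartialAlgebra.eval a (Γ.eqn e).rhs, b = c

/-- The homomorphisms of models: if `σ(a)` is defined with value `b`, then `σ(f a)` is defined
with value `f b`. -/
@[ext]
structure Model.Hom {Γ : EssentiallyAlgebraicTheory.{w}} (A B : Model Γ) where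
  /-- the underlying sorted function -/
  toFun : ∀ s, A.carrier s → B.carrier s
  map_op : ∀ σ a, ∀ b ∈ A.op σ a, toFun _ b ∈ B.op σ fun i => toFun _ (a i)

/-- The category `Mod(Γ)`. -/
instance (Γ : EssentiallyAlgebraicTheory.{w}) : Category.{w} (Model Γ) where
  Hom A B := Model.Hom A B
  id A := ⟨fun _ a => a, fun _ _ _ hb => hb⟩
  comp f g := ⟨fun s a => g.toFun s (f.toFun s a),
    fun σ a b hb => g.map_op σ _ _ (f.map_op σ a b hb)⟩

end EssentiallyAlgebraicTheory

/-! ## Collections of categories and implications between matrix conditions -/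

/-- A collection of (locally small) categories. -/
abbrev CategoryCollection := ∀ (C : Type (w + 1)) [Category.{w} C], Prop

namespace CategoryCollection

/-- Finitely complete categories. -/
def lex : CategoryCollection.{w} := fun C _ => HasFiniteLimits C

/-- Regular categories: finitely complete categories with coequalizers of kernel pairs and
pullback-stable regular epimorphisms. -/
def reg : CategoryCollection.{w} := fun C _ => Regular C

/-- Varieties. -/
def alg : CategoryCollection.{w} := fun C _ => ∃ T : EquationalTheory.{w}, Nonempty (C ≌ T.Alg)

/-- Essentially algebraic categories. -/
def essAlg : CategoryCollection.{w} := fun C _ =>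
  ∃ Γ : EssentiallyAlgebraicTheory.{w}, Nonempty (C ≌ Γ.Model)

/-- Regular essentially algebraic categories. -/
def regEssAlg : CategoryCollection.{w} := fun C _ => reg C ∧ essAlg C

/-- The members of `𝒞` that are pointed, i.e. have an object both initial and terminal. -/
def pointed (𝒞 : CategoryCollection.{w}) : CategoryCollection.{w} := fun C _ =>
  𝒞 C ∧ HasZeroObject C

end CategoryCollection

/-- `M₁ ⇒_𝒞 M₂`: every category in `𝒞` with `M₁`-closed relations has `M₂`-closed relations.
All the collections above consist of finitely complete categories, and finite limits are what
internal relations are defined with. -/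
def SimpleExtendedMatrix.Implies (𝒞 : CategoryCollection.{w}) (M₁ M₂ : SimpleExtendedMatrix) :
    Prop :=
  ∀ (C : Type (w + 1)) [Category.{w} C] [HasFiniteLimits C],
    𝒞 C → M₁.HasClosedRelations C → M₂.HasClosedRelations C

/-!
The implications restricted to a collection of categories are all equivalent to the combinatorial
condition that, for some rows `i_1, …, i_{n'}` of `M`, no left column agrees with the right column
in all of them.

The condition suffices in every finitely complete category (`hasClosedRelations_cube`): an
`n'`-ary relation `R` on `A` yields the `n`-ary relation on `A ^ n'` of all `(z_1, …, z_n)` for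
which the `a`-th components of the `z_{i_a}` form a tuple in `R`, and a suitable interpretation of the
variables of `M` in `A ^ n'` transforms the columns of `M` into columns of the cube, with right
column sent to right column.

It is equivalent to the nonexistence of an algebra `({0, 1}, p)` of `V_M` with `p` preserving the
relation of nonzero tuples (`exists_row_iff_not_exists_op`). Given such an algebra, all the
implications are refuted by a single category, the variety `V_M` with an additional constant. It is
pointed since `M` has a row, which makes `p` idempotent, so that the constant alone is a subalgebra.
It has `M`-closed relations (`hasClosedRelations_pointedTheory`), but the nonzero tuples form a
relation on `({0, 1}, p, 1)` which is not closed under the cube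
(`not_hasClosedRelations_cube_pointedTheory`).

That this variety belongs to all the collections holds for every variety: it has limits, computed on
underlying sets; it is regular, the regular epimorphisms being the surjective homomorphisms
(`Alg.isRegularEpi_iff`); and it is essentially algebraic, with one sort and all operations total.
-/

namespace EquationalTheory

open FirstOrder

variable {T : EquationalTheory.{w}}

instance : T.lang.IsAlgebraic := T.isAlgebraic

/-! ### Limits of algebras -/

instance : ConcreteCategory T.Alg fun A B => A.carrier →[T.lang] B.carrier where
  hom f := f
  ofHom f := f

/-- The homomorphism of structures underlying a morphism of algebras. -/
abbrev Alg.toHom {A B : T.Alg} (f : A ⟶ B) : A.carrier →[T.lang] B.carrier := f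

theorem Alg.hom_funMap {A B : T.Alg} (f : A ⟶ B) {n : ℕ} (σ : T.lang.Functions n)
    (a : Fin n → A.carrier) :
    f (Language.Structure.funMap σ a) = Language.Structure.funMap σ fun i => f (a i) :=
  Language.Hom.map_fun (Alg.toHom f) σ a

/-- A function commuting with the operations, as a morphism of algebras: there are no relation
symbols to preserve. -/
def Alg.homMk {A B : T.Alg} (f : A.carrier → B.carrier)
    (hf : ∀ {n : ℕ} (σ : T.lang.Functions n) (a : Fin n → A.carrier),
      f (Language.Structure.funMap σ a) = Language.Structure.funMap σ fun i => f (a i)) :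
    A ⟶ B :=
  ConcreteCategory.ofHom
    { toFun := f
      map_fun' := hf
      map_rel' := fun r => isEmptyElim r }

@[ext]
theorem Alg.hom_ext {A B : T.Alg} {f g : A ⟶ B} (h : ∀ a : A.carrier, f a = g a) : f = g :=
  ConcreteCategory.hom_ext f g h

/-- A structure satisfies all equations that hold in each member of a family of algebras to which
it has jointly injective homomorphisms. -/
theorem isModel_of_jointly_injective {X : Type u} [str : T.lang.Structure X] {ι : Type v}
    (B : ι → T.Alg) (f : ∀ i, X →[T.lang] (B i).carrier)
    (hf : ∀ a b : X, (∀ i, f i a = f i b) → a = b) : T.IsModel X str := by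
  intro e he a
  refine hf _ _ fun i => ?_
  rw [← Language.HomClass.realize_term, ← Language.HomClass.realize_term]
  exact (B i).isModel e he _

/-- The subalgebra of `A` with underlying set `S`. -/
def Alg.sub (A : T.Alg) (S : T.lang.Substructure A.carrier) : T.Alg where
  carrier := S
  isModel := isModel_of_jointly_injective (fun _ : Unit => A) (fun _ => S.subtype.toHom)
    fun _ _ h => Subtype.ext (h ())

section Limits

variable {J : Type w} [Category.{w} J] (F : J ⥤ T.Alg)

/-- The operations act componentwise on the compatible families of elements of a diagram. -/
instance sectionsStructure : T.lang.Structure (F ⋙ forget T.Alg).sections where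
  funMap σ a := ⟨fun j => Language.Structure.funMap (M := (F.obj j).carrier) σ fun i => (a i).1 j,
    fun {j j'} g => by
      refine (Alg.hom_funMap (F.map g) σ _).trans ?_
      congr 1
      funext i
      exact (a i).2 g⟩
  RelMap r := isEmptyElim r

/-- The algebra of compatible families of elements of a diagram. -/
def Alg.limit : T.Alg where
  carrier := (F ⋙ forget T.Alg).sections
  isModel := isModel_of_jointly_injective F.obj
    (fun j =>
      { toFun := fun a => a.1 j
        map_fun' := fun _ _ => rfl
        map_rel' := fun r => isEmptyElim r })
    fun _ _ h => Subtype.ext (funext h)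

/-- The projections from the algebra of compatible families. -/
def Alg.limitCone : Cone F where
  pt := Alg.limit F
  π :=
    { app := fun j => Alg.homMk (A := Alg.limit F) (fun a => a.1 j) fun _ _ => rfl
      naturality := fun _ _ g => by
        ext a
        exact (a.2 g).symm }

/-- The algebra of compatible families is the limit of the diagram. -/
def Alg.limitConeIsLimit : IsLimit (Alg.limitCone F) where
  lift s := Alg.homMk (B := Alg.limit F)
    (fun a => ⟨fun j => s.π.app j a, fun g => ConcreteCategory.congr_hom (s.w g) a⟩)
    fun σ a => Subtype.ext (funext fun j => Alg.hom_funMap (s.π.app j) σ a)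
  fac s j := rfl
  uniq s m h := by
    ext a
    exact Subtype.ext (funext fun j => ConcreteCategory.congr_hom (h j) a)

instance : HasLimitsOfSize.{w, w} T.Alg :=
  ⟨fun _ _ => ⟨fun F => ⟨⟨_, Alg.limitConeIsLimit F⟩⟩⟩⟩

instance : PreservesLimitsOfSize.{w, w} (forget T.Alg) :=
  ⟨⟨fun {F} => preservesLimit_of_preserves_limit_cone (Alg.limitConeIsLimit F)
    ((Types.isLimit_iff _).2 fun s hs => ⟨(⟨s, hs⟩ : (F ⋙ forget T.Alg).sections),
      fun _ => rfl, fun _ h => Subtype.ext (funext h)⟩).some⟩⟩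

instance : HasFiniteLimits T.Alg :=
  hasFiniteLimits_of_hasLimitsOfSize.{w, w} T.Alg

instance : PreservesFiniteLimits (forget T.Alg) :=
  PreservesLimitsOfSize.preservesFiniteLimits.{w, w} (forget T.Alg)

end Limits

theorem Alg.injective_of_mono {A B : T.Alg} (f : A ⟶ B) [Mono f] : Function.Injective f :=
  ConcreteCategory.injective_of_mono_of_preservesPullback f

/-- A function into an algebra is a homomorphism if its composite with an injective homomorphism
is one. -/
theorem Alg.exists_factor {A B C : T.Alg} (f : A ⟶ C) (g : B ⟶ C) (hg : Function.Injective g)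
    (h : A.carrier → B.carrier) (hh : ∀ a, g (h a) = f a) : ∃ k : A ⟶ B, k ≫ g = f := by
  refine ⟨Alg.homMk h fun σ a => hg ?_, Alg.hom_ext hh⟩
  rw [hh, Alg.hom_funMap, Alg.hom_funMap]
  simp only [hh]

/-! ### Varieties are regular categories -/

/-- The elements of a pullback of algebras include all pairs of elements with the same image. -/
theorem Alg.exists_of_isPullback {P A B C : T.Alg} {p : P ⟶ A} {q : P ⟶ B} {f : A ⟶ C} {g : B ⟶ C}
    (h : IsPullback p q f g) (a : A.carrier) (b : B.carrier) (hab : f a = g b) :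
    ∃ c : P.carrier, p c = a ∧ q c = b :=
  ((Types.isPullback_iff _ _ _ _).1 (h.map (forget T.Alg))).2.2 a b hab

/-- A surjective homomorphism is the coequalizer of each of its kernel pairs. -/
noncomputable def Alg.isColimitOfSurjective {P A B : T.Alg} {p q : P ⟶ A} {f : A ⟶ B}
    (h : IsKernelPair f p q) (hf : Function.Surjective f) :
    IsColimit (Cofork.ofπ f h.w) :=
  have key : ∀ (s : Cofork p q) (a b : A.carrier), f a = f b → s.π a = s.π b := by
    intro s a b hab
    obtain ⟨c, rfl, rfl⟩ := Alg.exists_of_isPullback h a b hab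
    exact ConcreteCategory.congr_hom s.condition c
  have key' : ∀ (s : Cofork p q) (a : A.carrier),
      s.π (Function.surjInv hf (f a)) = s.π a := fun s a =>
    key s _ _ (Function.surjInv_eq hf _)
  Cofork.IsColimit.mk _
    (fun s => Alg.homMk (A := B) (fun b => s.π (Function.surjInv hf b)) fun σ b => by
      have hb : b = fun i => f (Function.surjInv hf (b i)) :=
        funext fun i => (Function.surjInv_eq hf _).symm
      rw [← Alg.hom_funMap]
      conv_lhs => rw [hb, ← Alg.hom_funMap]
      exact key' s _)
    (fun s => Alg.hom_ext (key' s))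
    (fun s m hm => Alg.hom_ext fun b => by
      obtain ⟨a, rfl⟩ := hf b
      exact (ConcreteCategory.congr_hom hm a).trans (key' s a).symm)

/-- The image of a homomorphism. -/
abbrev Alg.image {A B : T.Alg} (f : A ⟶ B) : T.Alg := B.sub (Language.Hom.range (Alg.toHom f))

/-- The inclusion of the image of a homomorphism. -/
def Alg.imageInclusion {A B : T.Alg} (f : A ⟶ B) : Alg.image f ⟶ B :=
  Alg.homMk Subtype.val fun _ _ => rfl

/-- The restriction of a homomorphism to its image. -/
def Alg.toImage {A B : T.Alg} (f : A ⟶ B) : A ⟶ Alg.image f :=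
  Alg.homMk (fun a => ⟨f a, a, rfl⟩) fun σ a => Subtype.ext (Alg.hom_funMap f σ a)

theorem Alg.surjective_toImage {A B : T.Alg} (f : A ⟶ B) : Function.Surjective (Alg.toImage f) := by
  rintro ⟨_, a, rfl⟩
  exact ⟨a, rfl⟩

/-- The regular epimorphisms of a variety are the surjective homomorphisms. -/
theorem Alg.isRegularEpi_iff {A B : T.Alg} (f : A ⟶ B) :
    IsRegularEpi f ↔ Function.Surjective f := by
  constructor
  · rintro ⟨⟨hf⟩⟩ b
    -- The corestriction of `f` to its image factors through the coequalizer `f`, so the inclusion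
    -- of the image is a split epimorphism.
    have hw : hf.left ≫ Alg.toImage f = hf.right ≫ Alg.toImage f :=
      Alg.hom_ext fun a => Subtype.ext (ConcreteCategory.congr_hom hf.w a)
    have hd : f ≫ hf.isColimit.desc (Cofork.ofπ _ hw) = Alg.toImage f :=
      hf.isColimit.fac (Cofork.ofπ _ hw) WalkingParallelPair.one
    have hs : hf.isColimit.desc (Cofork.ofπ _ hw) ≫ Alg.imageInclusion f = 𝟙 B := by
      have : IsRegularEpi f := ⟨⟨hf⟩⟩
      rw [← cancel_epi f, reassoc_of% hd]
      rfl
    obtain ⟨a, ha⟩ := (hf.isColimit.desc (Cofork.ofπ _ hw) b).2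
    exact ⟨a, ha.trans (ConcreteCategory.congr_hom hs b)⟩
  · intro hf
    have h := IsKernelPair.of_hasPullback f
    exact ⟨⟨⟨_, _, _, h.w, Alg.isColimitOfSurjective h hf⟩⟩⟩

/-- A homomorphism and its restriction to the image have the same kernel pairs, and the latter is
surjective, hence their coequalizer. -/
instance : Regular T.Alg where
  hasCoequalizer_of_isKernelPair {A B P f p q} h := by
    have h' : IsKernelPair (Alg.toImage f) p q :=
      IsKernelPair.cancel_right (f₂ := Alg.imageInclusion f)
        (Alg.hom_ext fun a => Subtype.ext (ConcreteCategory.congr_hom h.w a)) h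
    exact ⟨⟨⟨_, Alg.isColimitOfSurjective h' (Alg.surjective_toImage f)⟩⟩⟩
  regularEpiIsStableUnderBaseChange :=
    { of_isPullback := fun {A B C P f g p q} h hg => by
        refine (Alg.isRegularEpi_iff _).2 fun a => ?_
        obtain ⟨b, hb⟩ := (Alg.isRegularEpi_iff _).1 hg (f a)
        obtain ⟨c, -, hc⟩ := Alg.exists_of_isPullback h b a hb
        exact ⟨c, hc⟩ }

end EquationalTheory

namespace EquationalTheory

open FirstOrder

/-! ### Varieties are essentially algebraic -/

variable (T : EquationalTheory.{w})

/-- The signature of a variety as a sorted signature with one sort. -/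
@[reducible]
def sortedSignature : SortedSignature PUnit.{w + 1} where
  Op := Σ n, T.lang.Functions n
  Arity σ := ULift (Fin σ.1)
  dom _ _ := ⟨⟩
  cod _ := ⟨⟩

variable {T}

/-- A term of the signature of a variety as a term of the sorted signature. -/
def toSortedTerm : T.lang.Term ℕ →
    T.sortedSignature.Term (fun _ : ULift.{w} ℕ => PUnit.unit) PUnit.unit
  | .var n => .var ⟨n⟩
  | .func f ts => .app (Sg := T.sortedSignature) ⟨_, f⟩ fun i => toSortedTerm (ts i.down)

/-- In a partial algebra whose operations are all total, given by an algebra structure, the partial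
value of a term is its value in this algebra structure. -/
theorem eval_toSortedTerm (A : T.sortedSignature.PartialAlgebra)
    [T.lang.Structure (A.carrier ⟨⟩)]
    (hA : ∀ (σ : T.sortedSignature.Op) (a : ULift (Fin σ.1) → A.carrier ⟨⟩),
      A.op σ a = Part.some (Language.Structure.funMap σ.2 fun i => a ⟨i⟩))
    (a : ULift.{w} ℕ → A.carrier ⟨⟩) (t : T.lang.Term ℕ) :
    A.eval a (toSortedTerm t) = Part.some (t.realize fun n => a ⟨n⟩) := by
  induction t with
  | var n => rfl
  | func f ts ih =>
    refine (Part.assert_pos fun i => ?_).trans ((hA _ _).trans ?_)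
    · rw [ih]
      trivial
    · simp only [ih, Part.get_some]
      rfl

variable (T) in
/-- A variety as an essentially algebraic theory: there is one sort, and all operations are
total. -/
@[reducible]
def toEssentiallyAlgebraicTheory : EssentiallyAlgebraicTheory.{w} where
  S := PUnit
  Sg := T.sortedSignature
  E := T.eqs
  EVar _ := ULift ℕ
  eSort _ _ := ⟨⟩
  eqn e := ⟨⟨⟩, toSortedTerm e.1.1, toSortedTerm e.1.2⟩
  total := Set.univ
  Def _ hσ := (hσ trivial).elim
  def_total _ hσ := (hσ trivial).elim

/-- The partial algebra, with one sort and total operations, given by an algebra. -/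
@[reducible]
def Alg.toPartialAlgebra (A : T.Alg) : T.sortedSignature.PartialAlgebra where
  carrier _ := A.carrier
  op σ a := Part.some (Language.Structure.funMap σ.2 fun i => a ⟨i⟩)

variable (T) in
/-- The algebras of a variety as models of the corresponding essentially algebraic theory. -/
def toModel : T.Alg ⥤ T.toEssentiallyAlgebraicTheory.Model where
  obj A :=
    { A.toPartialAlgebra with
      op_total := fun _ _ _ => trivial
      op_dom_iff := fun _ hσ => (hσ trivial).elim
      sat := by
        intro e a b hb c hc
        have h := @eval_toSortedTerm T A.toPartialAlgebra A.str (fun _ _ => rfl) a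
        replace hb : b ∈ A.toPartialAlgebra.eval a (toSortedTerm e.1.1) := hb
        replace hc : c ∈ A.toPartialAlgebra.eval a (toSortedTerm e.1.2) := hc
        rw [h, Part.mem_some_iff] at hb hc
        rw [hb, hc]
        exact A.isModel e.1 e.2 _ }
  map f :=
    { toFun := fun _ => f
      map_op := by
        rintro σ a b hb
        rw [Part.mem_some_iff] at hb ⊢
        rw [hb]
        exact Alg.hom_funMap f σ.2 _ }

instance : (toModel T).Faithful where
  map_injective h := Alg.hom_ext fun a =>
    congrFun (congrFun (congrArg EssentiallyAlgebraicTheory.Model.Hom.toFun h) ⟨⟩) a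

instance : (toModel T).Full where
  map_surjective f := ⟨Alg.homMk (f.toFun ⟨⟩) fun σ a =>
    Part.mem_some_iff.1 (f.map_op ⟨_, σ⟩ (fun i => a i.down) _ (Part.mem_some _)), rfl⟩

/-- The algebra structure of a model of the theory. -/
@[reducible]
def modelStructure (B : T.toEssentiallyAlgebraicTheory.Model) :
    T.lang.Structure (B.carrier ⟨⟩) where
  funMap σ a := (B.op ⟨_, σ⟩ fun i => a i.down).get (B.op_total _ trivial _)
  RelMap r := isEmptyElim r

/-- A model of the theory as an algebra of the variety. -/
def ofModel (B : T.toEssentiallyAlgebraicTheory.Model) : T.Alg :=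
  letI := modelStructure B
  { carrier := B.carrier ⟨⟩
    isModel := fun e he a => by
      have h := eval_toSortedTerm B.toPartialAlgebra
        (fun σ a => (Part.some_get (B.op_total σ trivial a)).symm) (fun n => a n.down)
      exact B.sat ⟨e, he⟩ (fun n => a n.down) _ ((h e.1).symm ▸ Part.mem_some _) _
        ((h e.2).symm ▸ Part.mem_some _) }

instance : (toModel T).EssSurj where
  mem_essImage B := ⟨ofModel B, ⟨{
    hom := ⟨fun _ a => a, fun σ a b hb => by
      rw [Part.mem_some_iff.1 hb]
      exact Part.get_mem _⟩
    inv := ⟨fun _ a => a, fun σ a b hb => Part.mem_some_iff.2 (Part.get_eq_of_mem hb _).symm⟩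
    hom_inv_id := rfl
    inv_hom_id := rfl }⟩⟩

instance : (toModel T).IsEquivalence where

theorem essAlg_alg (T : EquationalTheory.{w}) : CategoryCollection.essAlg T.Alg :=
  ⟨T.toEssentiallyAlgebraicTheory, ⟨(toModel T).asEquivalence⟩⟩

end EquationalTheory

namespace SimpleExtendedMatrix

open FirstOrder

/-! ### The combinatorial condition and closedness under the cube -/

/-- A tuple `c` whose binary value is `N ≠ 0` is the column with number `N - 1`, as the columns are
numbered from `0` and the zero tuple is omitted. -/
theorem exists_cube_column {n : ℕ} (hn : 2 ≤ n) (c : Fin n → Fin 2) (hc : c ≠ fun _ => 0) :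
    ∃ j, ∀ i, (cube n hn).x i j = c i := by
  set N := finFunctionFinEquiv fun i => c i.rev with hN
  have hN0 : (N : ℕ) ≠ 0 := by
    intro h
    apply hc
    have h0 : N = finFunctionFinEquiv fun _ : Fin n => (0 : Fin 2) := by
      apply Fin.ext
      rw [h, finFunctionFinEquiv_apply]
      simp
    funext i
    simpa using congrFun (finFunctionFinEquiv.injective h0) i.rev
  refine ⟨⟨N - 1, by have := N.isLt; change (N : ℕ) - 1 < 2 ^ n - 1; omega⟩, fun i => ?_⟩
  have : (⟨(N : ℕ) - 1 + 1, by have := N.isLt; omega⟩ : Fin (2 ^ n)) = N :=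
    Fin.ext (by simp only; omega)
  change finFunctionFinEquiv.symm (⟨(N : ℕ) - 1 + 1, _⟩ : Fin (2 ^ n)) i.rev = c i
  rw [this, hN, Equiv.symm_apply_apply]
  exact congrArg c (Fin.rev_rev _)

theorem cube_column_ne_zero {n : ℕ} (hn : 2 ≤ n) (j : Fin (cube n hn).m) :
    ∃ i, (cube n hn).x i j = (1 : Fin 2) := by
  by_contra! h
  have hj : (j : ℕ) + 1 < 2 ^ n := by
    have : (j : ℕ) < 2 ^ n - 1 := j.isLt
    omega
  have h0 : finFunctionFinEquiv.symm (⟨(j : ℕ) + 1, hj⟩ : Fin (2 ^ n)) =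
      fun _ : Fin n => (0 : Fin 2) := by
    funext i
    have h1 : finFunctionFinEquiv.symm (⟨(j : ℕ) + 1, hj⟩ : Fin (2 ^ n)) i.rev.rev ≠ (1 : Fin 2) :=
      h i.rev
    rw [Fin.rev_rev] at h1
    omega
  rw [Equiv.symm_apply_eq] at h0
  have := congrArg Fin.val h0
  rw [finFunctionFinEquiv_apply] at this
  simp at this

/-- If no left column of `M` agrees with the right column in all of the rows `i_1, …, i_{n'}`,
then `M`-closedness implies `Cube_{n'}`-closedness, in all finitely complete categories. A relation
`R` on `A` is turned into an `n`-ary relation on `A ^ n'`, relating `z_1, …, z_n` if `R` relates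
the `a`-th components of the `z_{i_a}`. A variable is interpreted in `A ^ n'` by choosing, in the component
`a`, the value of `x_1` if the variable is `y_{i_a}`, and the value of `x_2` otherwise. -/
theorem hasClosedRelations_cube {M : SimpleExtendedMatrix} {n' : ℕ} (hn' : 2 ≤ n')
    (i : Fin n' → Fin M.n) (hi : ¬ ∃ j : Fin M.m, ∀ a : Fin n', M.x (i a) j = M.y (i a))
    (C : Type u) [Category.{v} C] [HasFiniteLimits C] (hM : M.HasClosedRelations C) :
    (cube n' hn').HasClosedRelations C := by
  suffices H : ∀ (A R : C) (r : R ⟶ ∏ᶜ fun _ : Fin n' => A) [Mono r] (B : C) (f : Fin 2 → (B ⟶ A)),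
      (∀ j, ∃ g : B ⟶ R, g ≫ r = Pi.lift fun a : Fin n' => f ((cube n' hn').x a j)) →
        ∃ g : B ⟶ R, g ≫ r = Pi.lift fun _ : Fin n' => f 0 from
    fun A R r hr B f hf => @H A R r hr B f hf
  intro A R r _ B f hf
  let A' : C := ∏ᶜ fun _ : Fin n' => A
  let d : (∏ᶜ fun _ : Fin M.n => A') ⟶ ∏ᶜ fun _ : Fin n' => A :=
    Pi.lift fun a => Pi.π (fun _ : Fin M.n => A') (i a) ≫ Pi.π (fun _ : Fin n' => A) a
  let F : Fin M.k → (B ⟶ A') := fun z => Pi.lift fun a => if z = M.y (i a) then f 0 else f 1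
  have hd : ∀ z : Fin M.n → Fin M.k, Pi.lift (fun l => F (z l)) ≫ d =
      Pi.lift fun a => if z (i a) = M.y (i a) then f 0 else f 1 := by
    intro z
    apply Pi.hom_ext
    intro a
    simp [d, F]
  obtain ⟨g, hg⟩ := hM A' (pullback d r) (pullback.fst d r) B F fun j => by
    have hc : (fun a => if M.x (i a) j = M.y (i a) then (0 : Fin 2) else 1) ≠ fun _ => 0 := by
      intro h
      refine hi ⟨j, fun a => ?_⟩
      by_contra hne
      simpa [hne] using congrFun h a
    obtain ⟨l, hl⟩ := exists_cube_column hn' _ hc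
    obtain ⟨g, hg⟩ := hf l
    refine ⟨pullback.lift (Pi.lift fun l => F (M.x l j)) g ?_, pullback.lift_fst _ _ _⟩
    rw [hd, hg]
    congr 1
    funext a
    refine Eq.trans ?_ (congrArg f (hl a)).symm
    split_ifs <;> rfl
  refine ⟨g ≫ pullback.snd d r, ?_⟩
  rw [Category.assoc, ← pullback.condition, reassoc_of% hg, hd]
  simp only [if_true]

theorem isModel_opStructure_iff (M : SimpleExtendedMatrix) {A : Type u} (p : (Fin M.m → A) → A) :
    (theory.{w} M).IsModel A (M.opStructure p) ↔
      ∀ (i : Fin M.n) (a : ℕ → A), p (fun j => a (M.x i j)) = a (M.y i) :=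
  Set.forall_mem_range

/-- A valuation of the variables as a valuation of the infinite supply of variables used for the
terms. -/
theorem exists_extend {k : ℕ} {A : Type u} [Nonempty A] (b : Fin k → A) :
    ∃ a : ℕ → A, ∀ z : Fin k, a z = b z :=
  ⟨fun n => if h : n < k then b ⟨n, h⟩ else Classical.arbitrary A, fun z => by simp⟩

/-- If the combinatorial condition holds, then the nonzero tuples `r_j = ([x_{i_a j} ≠ y_{i_a}])_a`
are sent to zero by every `p` satisfying the axioms of `V_M`. If it fails, then an operation as
required is the one with `p(z) = 0` exactly when an axiom of `V_M` demands it: this is consistent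
with the axioms demanding the value `1`, since some left column agrees with the right column in any
two given rows. -/
theorem exists_row_iff_not_exists_op (M : SimpleExtendedMatrix) {n' : ℕ} (hn' : 2 ≤ n') :
    (∃ i : Fin n' → Fin M.n, ¬ ∃ j : Fin M.m, ∀ a : Fin n', M.x (i a) j = M.y (i a)) ↔
    ¬ ∃ p : (Fin M.m → Fin 2) → Fin 2,
        (SimpleExtendedMatrix.theory.{w} M).IsModel (Fin 2) (M.opStructure p) ∧
          ∀ r : Fin M.m → Fin n' → Fin 2,
            (∀ j, r j ≠ fun _ => 0) → (fun a => p fun j => r j a) ≠ fun _ => 0 := by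
  constructor
  · rintro ⟨i, hi⟩ ⟨p, hp, hr⟩
    rw [isModel_opStructure_iff] at hp
    refine hr (fun j a => if M.x (i a) j = M.y (i a) then 0 else 1) ?_ ?_
    · intro j h
      refine hi ⟨j, fun a => ?_⟩
      by_contra hne
      simpa [hne] using congrFun h a
    · funext a
      obtain ⟨b, hb⟩ := exists_extend fun z => if z = M.y (i a) then (0 : Fin 2) else 1
      simpa [hb] using hp (i a) b
  · contrapose!
    intro h
    classical
    let P : (Fin M.m → Fin 2) → Prop := fun z =>
      ∃ (i : Fin M.n) (b : ℕ → Fin 2), (z = fun j => b (M.x i j)) ∧ b (M.y i) = 0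
    refine ⟨fun z => if P z then 0 else 1, (isModel_opStructure_iff M _).2 fun i b => ?_, ?_⟩
    · by_cases hb : b (M.y i) = 0
      · rw [if_pos ⟨i, b, rfl, hb⟩, hb]
      · rw [if_neg]
        · omega
        · -- In a column agreeing with `y` in the rows `i` and `i'`, the entry of `z` would be both
          -- `b (y_i) ≠ 0` and `b' (y_{i'}) = 0`.
          rintro ⟨i', b', hz, hb'⟩
          obtain ⟨j, hj⟩ := h fun a => if (a : ℕ) = 0 then i else i'
          have h0 : M.x i j = M.y i := by simpa using hj ⟨0, by omega⟩
          have h1 : M.x i' j = M.y i' := by simpa using hj ⟨1, by omega⟩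
          have := congrFun hz j
          rw [h0, h1, hb'] at this
          exact hb this
    · intro r hr hp
      have hP : ∀ a, P fun j => r j a := by
        intro a
        by_contra hn
        simpa [hn] using congrFun hp a
      -- If `p` vanishes in each component `a` because of an axiom `i a`, then the `j`-th argument
      -- vanishes for each column `j` agreeing with `y` in all the rows `i a`.
      choose i b hb hy using hP
      obtain ⟨j, hj⟩ := h i
      refine hr j (funext fun a => ?_)
      have := congrFun (hb a) j
      simp only [hj, hy] at this
      exact this

/-! ### The pointed variety of a matrix -/

/-- The signature with an operation symbol of arity `m` and a constant. -/
inductive PointedOp (m : ℕ) : ℕ → Type w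
  | p : PointedOp m m
  | e : PointedOp m 0

/-- The theory of `V_M` with an additional constant. -/
def pointedTheory (M : SimpleExtendedMatrix) : EquationalTheory.{w} where
  lang := ⟨PointedOp M.m, fun _ => PEmpty⟩
  isAlgebraic := fun _ => inferInstanceAs (IsEmpty PEmpty)
  eqs := Set.range fun i : Fin M.n =>
    (Language.Term.func (PointedOp.p : PointedOp M.m M.m)
        fun j => Language.Term.var (M.x i j : ℕ),
      Language.Term.var (M.y i : ℕ))

variable {M : SimpleExtendedMatrix}

/-- The algebra `(A, p, e)`. -/
def pointedAlg {A : Type w} (p : (Fin M.m → A) → A) (e : A)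
    (h : ∀ (i : Fin M.n) (a : ℕ → A), p (fun j => a (M.x i j)) = a (M.y i)) :
    (pointedTheory.{w} M).Alg where
  carrier := A
  str :=
    { funMap := fun {_} σ => match σ with
        | .p => p
        | .e => fun _ => e
      RelMap := fun {_} r => PEmpty.elim r }
  isModel := Set.forall_mem_range.2 h

/-- The operation `p` of an algebra. -/
def op (A : (pointedTheory.{w} M).Alg) (a : Fin M.m → A.carrier) : A.carrier :=
  Language.Structure.funMap (L := (pointedTheory.{w} M).lang) (PointedOp.p : PointedOp M.m M.m) a

/-- The constant of an algebra. -/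
def pt (A : (pointedTheory.{w} M).Alg) : A.carrier :=
  Language.Structure.funMap (L := (pointedTheory.{w} M).lang) (PointedOp.e : PointedOp M.m 0)
    Fin.elim0

theorem op_row (A : (pointedTheory.{w} M).Alg) (i : Fin M.n) (b : Fin M.k → A.carrier) :
    op A (fun j => b (M.x i j)) = b (M.y i) := by
  have : Nonempty A.carrier := ⟨pt A⟩
  obtain ⟨a, ha⟩ := exists_extend b
  have h : op A (fun j => a (M.x i j)) = a (M.y i) := A.isModel _ ⟨i, rfl⟩ a
  simpa only [ha] using h

theorem map_op {A B : (pointedTheory.{w} M).Alg} (f : A ⟶ B) (a : Fin M.m → A.carrier) :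
    f (op A a) = op B fun j => f (a j) :=
  EquationalTheory.Alg.hom_funMap f _ a

theorem map_pt {A B : (pointedTheory.{w} M).Alg} (f : A ⟶ B) : f (pt A) = pt B :=
  (EquationalTheory.Alg.hom_funMap f _ _).trans (congrArg _ (Subsingleton.elim _ _))

/-- A function preserving `p` and the constant, as a homomorphism. -/
def pointedHom {A B : (pointedTheory.{w} M).Alg} (f : A.carrier → B.carrier)
    (hp : ∀ a, f (op A a) = op B fun j => f (a j)) (he : f (pt A) = pt B) : A ⟶ B :=
  EquationalTheory.Alg.homMk f fun {n} σ a => by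
    change PointedOp M.m n at σ
    cases σ with
    | p => exact hp a
    | e =>
      have h : a = Fin.elim0 := Subsingleton.elim _ _
      subst h
      exact he.trans (congrArg _ (Subsingleton.elim _ _))

/-- The constant forms a subalgebra, as `M` has a row: its axiom makes `p` idempotent. -/
theorem op_pt (A : (pointedTheory.{w} M).Alg) : op A (fun _ => pt A) = pt A :=
  op_row A ⟨0, M.n_pos⟩ fun _ => pt A

/-- The trivial algebra is a zero object. -/
instance : HasZeroObject (pointedTheory.{w} M).Alg :=
  ⟨pointedAlg (A := PUnit) (fun _ => ⟨⟩) ⟨⟩ fun _ _ => rfl,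
    { unique_to := fun A => ⟨⟨⟨pointedHom (fun _ => pt A) (fun _ => (op_pt A).symm) rfl⟩,
        fun f => EquationalTheory.Alg.hom_ext fun _ => map_pt f⟩⟩
      unique_from := fun _ => ⟨⟨⟨pointedHom (fun _ => PUnit.unit) (fun _ => rfl) rfl⟩,
        fun _ => EquationalTheory.Alg.hom_ext fun _ => rfl⟩⟩ }⟩

/-- Applying `p` to the factorizations of the left columns gives a factorization of the right
column. It is a homomorphism, although `p` need not be, since relations are injective. -/
theorem hasClosedRelations_pointedTheory (M : SimpleExtendedMatrix) :
    M.HasClosedRelations (pointedTheory.{w} M).Alg := by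
  intro A R r _ B f hf
  choose g hg using hf
  refine EquationalTheory.Alg.exists_factor _ r (EquationalTheory.Alg.injective_of_mono r)
    (fun b => op R fun j => g j b) fun b => ?_
  refine Concrete.limit_ext _ _ _ ?_
  rintro ⟨i⟩
  change Pi.π (fun _ : Fin M.n => A) i _ = Pi.π (fun _ : Fin M.n => A) i _
  have h1 : ∀ j, Pi.π (fun _ : Fin M.n => A) i (r (g j b)) = f (M.x i j) b := fun j => by
    rw [← ConcreteCategory.comp_apply, ← ConcreteCategory.comp_apply, ← Category.assoc, hg]
    simp
  have h2 : Pi.π (fun _ : Fin M.n => A) i (Pi.lift (fun i => f (M.y i)) b) = f (M.y i) b := by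
    rw [← ConcreteCategory.comp_apply]
    simp
  rw [map_op, map_op, h2]
  simp only [h1]
  exact op_row A i fun z => f z b

/-- If `p` preserves the relation `R` of nonzero tuples, then `R` is a relation on `({0, 1}, p, 1)`
that is not closed under the cube: for `x_1` and `x_2` interpreted as the identity and the
homomorphism with constant value `1`, the left columns factor through `R`, but the right column
does not. -/
theorem not_hasClosedRelations_cube_pointedTheory {n' : ℕ} (hn' : 2 ≤ n')
    (p : (Fin M.m → Fin 2) → Fin 2)
    (hp : (theory.{v} M).IsModel (Fin 2) (M.opStructure p))
    (hr : ∀ r : Fin M.m → Fin n' → Fin 2,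
      (∀ j, r j ≠ fun _ => 0) → (fun a => p fun j => r j a) ≠ fun _ => 0) :
    ¬ (cube n' hn').HasClosedRelations (pointedTheory.{w} M).Alg := by
  rw [isModel_opStructure_iff] at hp
  let A : (pointedTheory.{w} M).Alg := pointedAlg (A := ULift (Fin 2))
    (fun a => ⟨p fun j => (a j).down⟩) ⟨1⟩ fun i a => ULift.ext _ _ (hp i fun n => (a n).down)
  let P : (pointedTheory.{w} M).Alg := ∏ᶜ fun _ : Fin n' => A
  let π : ∀ a : Fin n', P ⟶ A := Pi.π fun _ : Fin n' => A
  let S : (pointedTheory.{w} M).lang.Substructure P.carrier :=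
    { carrier := {c | ∃ a, π a c ≠ ⟨0⟩}
      fun_mem := fun {n} σ => match σ with
        | .p => fun c hc => by
          by_contra! h
          have h' : ∀ a, π a (op P c) = ⟨0⟩ := fun a => not_not.1 fun hne => h ⟨a, hne⟩
          refine hr (fun j a => (π a (c j)).down) ?_ (funext fun a => ?_)
          · intro j h0
            obtain ⟨a, ha⟩ := hc j
            exact ha (ULift.ext _ _ (congrFun h0 a))
          · have := h' a
            rw [map_op] at this
            exact congrArg ULift.down this
        | .e => fun c _ => by
          refine ⟨⟨0, by omega⟩, ?_⟩
          have : c = Fin.elim0 := Subsingleton.elim _ _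
          subst this
          intro h
          have := (map_pt (π ⟨0, by omega⟩)).symm.trans h
          exact absurd (congrArg ULift.down this) one_ne_zero }
  intro h
  let r : P.sub S ⟶ P := EquationalTheory.Alg.homMk Subtype.val fun _ _ => rfl
  have hr_inj : Function.Injective r := Subtype.val_injective
  have : Mono r := ConcreteCategory.mono_of_injective r hr_inj
  let c : A ⟶ A := pointedHom (fun _ => pt A) (fun _ => (op_pt A).symm) rfl
  let f : Fin 2 → (A ⟶ A) := ![𝟙 A, c]
  have hπ (t : Fin n' → (A ⟶ A)) (a : Fin n') (b : A.carrier) : π a (Pi.lift t b) = t a b := by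
    rw [← ConcreteCategory.comp_apply]
    simp [π]
  obtain ⟨g, hg⟩ := @h A (P.sub S) r this A f fun j => by
    refine EquationalTheory.Alg.exists_factor _ r hr_inj
      (fun b => ⟨Pi.lift (fun i => f ((cube n' hn').x i j)) b, ?_⟩) fun _ => rfl
    obtain ⟨a, ha⟩ := cube_column_ne_zero hn' j
    refine ⟨a, fun h0 => ?_⟩
    have h1 := (hπ _ a b).symm.trans h0
    rw [ha] at h1
    exact one_ne_zero (congrArg ULift.down h1)
  obtain ⟨a, ha⟩ := (g ⟨0⟩).2
  exact ha ((congrArg (π a) (ConcreteCategory.congr_hom hg ⟨0⟩)).trans (hπ _ a ⟨0⟩))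

end SimpleExtendedMatrix

/-! ### The equivalences -/

open SimpleExtendedMatrix

/-- A pointed variety with `M`-closed relations but without `Cube_{n'}`-closed relations refutes
all the implications, being in particular a regular essentially algebraic category. -/
theorem exists_row_of_implies (M : SimpleExtendedMatrix) {n' : ℕ} (hn' : 2 ≤ n')
    (𝒞 : CategoryCollection.{w})
    (h𝒞 : ∀ T : EquationalTheory.{w}, HasZeroObject T.Alg → 𝒞 T.Alg)
    (h : M.Implies 𝒞 (.cube n' hn')) :
    ∃ i : Fin n' → Fin M.n, ¬ ∃ j : Fin M.m, ∀ a : Fin n', M.x (i a) j = M.y (i a) := by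
  rw [exists_row_iff_not_exists_op.{0} M hn']
  rintro ⟨p, hp, hr⟩
  exact not_hasClosedRelations_cube_pointedTheory hn' p hp hr
    (h _ (h𝒞 _ inferInstance) (hasClosedRelations_pointedTheory M))

theorem mainTheorem1 (M : SimpleExtendedMatrix) (n' : ℕ) (hn' : 2 ≤ n') :
    List.TFAE [
      M.Implies CategoryCollection.lex.{w} (.cube n' hn'),
      M.Implies CategoryCollection.lex.{w}.pointed (.cube n' hn'),
      M.Implies CategoryCollection.reg.{w} (.cube n' hn'),
      M.Implies CategoryCollection.reg.{w}.pointed (.cube n' hn'),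
      M.Implies CategoryCollection.alg.{w} (.cube n' hn'),
      M.Implies CategoryCollection.alg.{w}.pointed (.cube n' hn'),
      M.Implies CategoryCollection.essAlg.{w} (.cube n' hn'),
      M.Implies CategoryCollection.essAlg.{w}.pointed (.cube n' hn'),
      M.Implies CategoryCollection.regEssAlg.{w} (.cube n' hn'),
      M.Implies CategoryCollection.regEssAlg.{w}.pointed (.cube n' hn'),
      ∃ i : Fin n' → Fin M.n, ¬ ∃ j : Fin M.m, ∀ a : Fin n', M.x (i a) j = M.y (i a),
      ¬ ∃ p : (Fin M.m → Fin 2) → Fin 2,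
        (SimpleExtendedMatrix.theory.{0} M).IsModel (Fin 2) (M.opStructure p) ∧
          ∀ r : Fin M.m → Fin n' → Fin 2,
            (∀ j, r j ≠ fun _ => 0) → (fun a => p fun j => r j a) ≠ fun _ => 0] := by
  have key : ∀ 𝒞 : CategoryCollection.{w},
      (∀ T : EquationalTheory.{w}, HasZeroObject T.Alg → 𝒞 T.Alg) →
        (M.Implies 𝒞 (.cube n' hn') ↔
          ∃ i : Fin n' → Fin M.n, ¬ ∃ j : Fin M.m, ∀ a : Fin n', M.x (i a) j = M.y (i a)) :=
    fun 𝒞 h𝒞 => ⟨exists_row_of_implies M hn' 𝒞 h𝒞, fun ⟨i, hi⟩ C _ _ _ hM =>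
      hasClosedRelations_cube hn' i hi C hM⟩
  have hlex (T : EquationalTheory.{w}) : CategoryCollection.lex T.Alg :=
    inferInstanceAs (HasFiniteLimits T.Alg)
  have hreg (T : EquationalTheory.{w}) : CategoryCollection.reg T.Alg :=
    inferInstanceAs (Regular T.Alg)
  have halg (T : EquationalTheory.{w}) : CategoryCollection.alg T.Alg := ⟨T, ⟨.refl⟩⟩
  have hess := EquationalTheory.essAlg_alg.{w}
  apply List.tfae_of_forall
    (∃ i : Fin n' → Fin M.n, ¬ ∃ j : Fin M.m, ∀ a : Fin n', M.x (i a) j = M.y (i a))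
  simp only [List.forall_mem_cons, List.not_mem_nil, false_imp_iff, implies_true, true_and, and_true]
  exact ⟨key _ fun T _ => hlex T, key _ fun T h => ⟨hlex T, h⟩,
    key _ fun T _ => hreg T, key _ fun T h => ⟨hreg T, h⟩,
    key _ fun T _ => halg T, key _ fun T h => ⟨halg T, h⟩,
    key _ fun T _ => hess T, key _ fun T h => ⟨hess T, h⟩,
    key _ fun T _ => ⟨hreg T, hess T⟩, key _ fun T h => ⟨⟨hreg T, hess T⟩, h⟩,
    (exists_row_iff_not_exists_op M hn').symm⟩
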